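/- Let $V$ be a set of propositional variables. Formulas of propositional constructive logic with strong negation (CLSN, Nelson logic) are built from $V$ with $\wedge,\vee,\to$, weak negation $\neg$ and strong negation $\sim$; write $\alpha\leftrightarrow\beta$ for $(\alpha\to\beta)\wedge(\beta\to\alpha)$. The theorems of CLSN are the formulas derivable by modus ponens from all instances of: the axioms of positive intuitionistic logic, $\alpha\to(\beta\to\alpha)$, $(\alpha\to(\beta\to\gamma))\to((\alpha\to\beta)\to(\alpha\to\gamma))$, $\alpha\wedge\beta\to\alpha$, $\alpha\wedge\beta\to\beta$, $(\alpha\to\beta)\to((\alpha\to\gamma)\to(\alpha\to\beta\wedge\gamma))$, $\alpha\to\alpha\vee\beta$, $\beta\to\alpha\vee\beta$, $(\alpha\to\gamma)\to((\beta\to\gamma)\to(\alpha\vee\beta\to\gamma))$; the axioms of weak negation, $(\alpha\to\beta)\to((\alpha\to\neg\beta)\to\neg\alpha)$ and $\neg\alpha\to(\alpha\to\beta)$; and the axioms of strong negation, ${\sim}\alpha\to(\alpha\to\beta)$, ${\sim}(\alpha\to\beta)\leftrightarrow\alpha\wedge{\sim}\beta$, ${\sim}(\alpha\wedge\beta)\leftrightarrow{\sim}\alpha\vee{\sim}\beta$,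 ${\sim}(\alpha\vee\beta)\leftrightarrow{\sim}\alpha\wedge{\sim}\beta$, ${\sim}\neg\alpha\leftrightarrow\alpha$, ${\sim}{\sim}\alpha\leftrightarrow\alpha$. A Nelson algebra $(A,\vee,\wedge,\to,{\sim},0,1)$ is a bounded distributive lattice such that, for all $a,b,c$: ${\sim}{\sim}a=a$; $a\le b$ iff ${\sim}b\le{\sim}a$; $a\wedge{\sim}a\le b\vee{\sim}b$; $a\wedge c\le{\sim}a\vee b$ iff $c\le a\to b$; and $(a\wedge b)\to c=a\to(b\to c)$. Put $\neg a=a\to 0$. A formula is valid in $A$ if it takes the value $1$ under every valuation of the variables in $A$. Let $R$ be a quasiorder (a reflexive transitive relation) on a set $U$ and $R(x)=\{y : x\,R\,y\}$. For $X\subseteq U$ let $X_R=\{x : R(x)\subseteq X\}$ and $X^R=\{x : R(x)\cap X\ne\emptyset\}$. The rough set-based Nelson algebra determined by $R$, denoted $\mathbb{IRS}_R(U)$, is the set $\{(X_R,X^R) : X\subseteq U\}$ ordered by componentwise inclusion, with componentwise union and intersection as join and meet, and with $${\sim}(A,B)=(U\setminus B,\,U\setminus A),\qquad (A,B)\to(C,D)=\big(((U\setminus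 A)\cup C)_R,\ (U\setminus A)\cup D\big).$$ Theorem. For every formula $\alpha$ of CLSN the following conditions are equivalent: (a) $\alpha$ is a theorem of CLSN; (b) $\alpha$ is valid in every finite Nelson algebra of the form $\mathbb{IRS}_R(U)$ with $R$ a quasiorder on a set $U$; (c) $\alpha$ is valid in $\mathbb{IRS}_R(U)$ for every quasiorder $R$ on a finite set $U$. -/

import Mathlib

universe u v

/-! ### Nelson algebras -/

/-- A Nelson algebra: a Kleene algebra (bounded distributive lattice with a strong negation `snot`
satisfying the first three laws) with a weak relative pseudocomplementation `wimp`. -/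
class NelsonAlgebra (A : Type u) extends DistribLattice A, BoundedOrder A where
  /-- strong negation -/
  snot : A → A
  /-- weak relative pseudocomplementation -/
  wimp : A → A → A
  snot_snot : ∀ a : A, snot (snot a) = a
  le_iff_snot_le_snot : ∀ a b : A, a ≤ b ↔ snot b ≤ snot a
  inf_snot_le_sup_snot : ∀ a b : A, a ⊓ snot a ≤ b ⊔ snot b
  le_wimp_iff : ∀ a b c : A, a ⊓ c ≤ snot a ⊔ b ↔ c ≤ wimp a b
  wimp_wimp : ∀ a b c : A, wimp (a ⊓ b) c = wimp a (wimp b c)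

namespace NelsonAlgebra

/-- Weak negation. -/
def wnot {A : Type u} [NelsonAlgebra A] (a : A) : A := wimp a ⊥

end NelsonAlgebra

/-! ### Constructive logic with strong negation: language and Hilbert calculus -/

/-- Propositional formulas over the propositional variables `V`; `neg` is the weak negation and
`sneg` the strong negation. -/
inductive NelsonFormula (V : Type v) : Type v
  | var : V → NelsonFormula V
  | conj : NelsonFormula V → NelsonFormula V → NelsonFormula V
  | disj : NelsonFormula V → NelsonFormula V → NelsonFormula V
  | imp : NelsonFormula V → NelsonFormula V → NelsonFormula V
  | neg : NelsonFormula V → NelsonFormula V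
  | sneg : NelsonFormula V → NelsonFormula V

namespace NelsonFormula

infixr:70 " ⩓ " => NelsonFormula.conj
infixr:65 " ⩔ " => NelsonFormula.disj
infixr:60 " ⇀ " => NelsonFormula.imp
prefix:80 "¬ₙ" => NelsonFormula.neg
prefix:80 "∼ₙ" => NelsonFormula.sneg

/-- `α ↔ β` abbreviates `(α → β) ∧ (β → α)`. -/
def equ {V : Type v} (α β : NelsonFormula V) : NelsonFormula V := (α ⇀ β) ⩓ (β ⇀ α)

infix:55 " ⇌ₙ " => NelsonFormula.equ

/-- The theorems of constructive logic with strong negation: the axioms of intuitionistic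
propositional logic for `∧, ∨, →, ¬`, the axioms for the strong negation `∼`, and modus ponens. -/
inductive IsTheorem {V : Type v} : NelsonFormula V → Prop
  | imp_const (α β : NelsonFormula V) : IsTheorem (α ⇀ β ⇀ α)
  | imp_distrib (α β γ : NelsonFormula V) :
      IsTheorem ((α ⇀ β ⇀ γ) ⇀ (α ⇀ β) ⇀ (α ⇀ γ))
  | conj_left (α β : NelsonFormula V) : IsTheorem (α ⩓ β ⇀ α)
  | conj_right (α β : NelsonFormula V) : IsTheorem (α ⩓ β ⇀ β)
  | conj_intro (α β γ : NelsonFormula V) :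
      IsTheorem ((α ⇀ β) ⇀ (α ⇀ γ) ⇀ (α ⇀ β ⩓ γ))
  | disj_left (α β : NelsonFormula V) : IsTheorem (α ⇀ α ⩔ β)
  | disj_right (α β : NelsonFormula V) : IsTheorem (β ⇀ α ⩔ β)
  | disj_elim (α β γ : NelsonFormula V) :
      IsTheorem ((α ⇀ γ) ⇀ (β ⇀ γ) ⇀ (α ⩔ β ⇀ γ))
  | neg_intro (α β : NelsonFormula V) : IsTheorem ((α ⇀ β) ⇀ (α ⇀ ¬ₙβ) ⇀ ¬ₙα)
  | neg_elim (α β : NelsonFormula V) : IsTheorem (¬ₙα ⇀ α ⇀ β)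
  | sneg_elim (α β : NelsonFormula V) : IsTheorem (∼ₙα ⇀ α ⇀ β)
  | sneg_imp (α β : NelsonFormula V) : IsTheorem (∼ₙ(α ⇀ β) ⇌ₙ α ⩓ ∼ₙβ)
  | sneg_conj (α β : NelsonFormula V) : IsTheorem (∼ₙ(α ⩓ β) ⇌ₙ ∼ₙα ⩔ ∼ₙβ)
  | sneg_disj (α β : NelsonFormula V) : IsTheorem (∼ₙ(α ⩔ β) ⇌ₙ ∼ₙα ⩓ ∼ₙβ)
  | sneg_neg (α : NelsonFormula V) : IsTheorem (∼ₙ(¬ₙα) ⇌ₙ α)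
  | sneg_sneg (α : NelsonFormula V) : IsTheorem (∼ₙ(∼ₙα) ⇌ₙ α)
  | modus_ponens {α β : NelsonFormula V} :
      IsTheorem (α ⇀ β) → IsTheorem α → IsTheorem β

/-- The value of a formula in a Nelson algebra under a valuation of the variables. -/
def eval {V : Type v} {A : Type u} [NelsonAlgebra A] (val : V → A) : NelsonFormula V → A
  | .var p => val p
  | .conj α β => eval val α ⊓ eval val β
  | .disj α β => eval val α ⊔ eval val β
  | .imp α β => NelsonAlgebra.wimp (eval val α) (eval val β)
  | .neg α => NelsonAlgebra.wnot (eval val α)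
  | .sneg α => NelsonAlgebra.snot (eval val α)

/-- A formula is valid in a Nelson algebra if its value is `1` under every valuation. -/
def ValidIn {V : Type v} (A : Type u) [NelsonAlgebra A] (α : NelsonFormula V) : Prop :=
  ∀ val : V → A, eval val α = ⊤

end NelsonFormula

/-! ### Rough sets determined by a binary relation -/

section RoughSets

variable {U : Type u}

/-- The lower approximation `X_R = {x | R(x) ⊆ X}`, where `R(x) = {y | x R y}`. -/
def lowerApprox (R : U → U → Prop) (X : Set U) : Set U := {x | ∀ y, R x y → y ∈ X}

/-- The upper approximation `X^R = {x | R(x) ∩ X ≠ ∅}`. -/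
def upperApprox (R : U → U → Prop) (X : Set U) : Set U := {x | ∃ y, R x y ∧ y ∈ X}

/-- The increasing representation of the rough sets of `R`: all pairs `(X_R, X^R)`, ordered by
componentwise inclusion (the order inherited from `Set U × Set U`). -/
def IRS (R : U → U → Prop) : Type u :=
  {p : Set U × Set U // ∃ X : Set U, p = (lowerApprox R X, upperApprox R X)}

/-- For a quasiorder, some set and its complement both meet every `R(x)` none of whose elements
is `R`-closed. -/
theorem exists_splitting_set (R : U → U → Prop) [IsPreorder U R] :
    ∃ Y : Set U, ∀ x, (∀ y, R x y → ∃ z, R y z ∧ z ≠ y) →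
      (∃ y, R x y ∧ y ∈ Y) ∧ (∃ y, R x y ∧ y ∉ Y) := by
  let Q : Set (Set (U × Bool)) :=
    {T | ∀ x b, (x, b) ∈ T → (x, !b) ∉ T ∧ ∃ y, R x y ∧ (y, !b) ∈ T}
  obtain ⟨T, hT⟩ : ∃ T, Maximal (· ∈ Q) T := by
    refine zorn_subset Q ?_
    intro c hc hch
    refine ⟨⋃₀ c, ?_, fun s hs => Set.subset_sUnion_of_mem hs⟩
    rintro x b ⟨t, ht, hx⟩
    refine ⟨?_, ?_⟩
    · rintro ⟨s, hs, hx'⟩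
      rcases hch.total ht hs with h | h
      · exact ((hc hs) x b (h hx)).1 hx'
      · exact ((hc ht) x b hx).1 (h hx')
    · obtain ⟨y, hy, hy'⟩ := ((hc ht) x b hx).2
      exact ⟨y, hy, t, ht, hy'⟩
  have hQ : T ∈ Q := hT.prop
  have key : ∀ x, (∀ y, R x y → ∃ z, R y z ∧ z ≠ y) → ∃ y b, R x y ∧ (y, b) ∈ T := by
    intro x hx
    by_contra! hno
    -- any admissible piece inside `R(x)` contradicts maximality
    have ext : ∀ T' : Set (U × Bool), T' ∈ Q → (∀ y b, (y, b) ∈ T' → R x y) → T' = ∅ := by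
      intro T' hT' hsub
      have hmem : T ∪ T' ∈ Q := by
        rintro y b (hy | hy)
        · refine ⟨?_, ?_⟩
          · rintro (h | h)
            · exact (hQ y b hy).1 h
            · exact hno y b (hsub _ _ h) hy
          · obtain ⟨z, hz, hz'⟩ := (hQ y b hy).2
            exact ⟨z, hz, Or.inl hz'⟩
        · refine ⟨?_, ?_⟩
          · rintro (h | h)
            · exact hno y _ (hsub _ _ hy) h
            · exact (hT' y b hy).1 h
          · obtain ⟨z, hz, hz'⟩ := (hT' y b hy).2
            exact ⟨z, hz, Or.inr hz'⟩
      have hle : T ∪ T' ⊆ T := hT.le_of_ge hmem Set.subset_union_left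
      ext ⟨y, b⟩
      simp only [Set.mem_empty_iff_false, iff_false]
      intro hy
      exact hno y b (hsub _ _ hy) (hle (Or.inr hy))
    by_cases hcyc : ∃ y z, R x y ∧ R y z ∧ R z y ∧ z ≠ y
    · obtain ⟨y, z, hxy, hyz, hzy, hne⟩ := hcyc
      have h := ext {(y, true), (z, false)} ?_ ?_
      · have : (y, true) ∈ (∅ : Set (U × Bool)) := h ▸ Or.inl rfl
        exact this
      · rintro w b (h | h)
        · cases h
          exact ⟨by simp [Ne.symm hne], z, hyz, by simp⟩
        · cases h
          exact ⟨by simp [hne], y, hzy, by simp⟩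
      · rintro w b (h | h)
        · cases h; exact hxy
        · cases h; exact IsTrans.trans _ _ _ hxy hyz
    · push Not at hcyc
      choose! f hf hf' using hx
      have hs : ∀ n : ℕ, R x (f^[n] x) := by
        intro n
        induction n with
        | zero => exact Std.Refl.refl x
        | succ n ih =>
          rw [Function.iterate_succ_apply']
          exact IsTrans.trans _ _ _ ih (hf _ ih)
      have hmono : ∀ m k : ℕ, R (f^[m] x) (f^[m + k] x) := by
        intro m k
        induction k with
        | zero => exact Std.Refl.refl _
        | succ k ih =>
          rw [← add_assoc, Function.iterate_succ_apply']
          exact IsTrans.trans _ _ _ ih (hf _ (hs _))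
      have hlt : ∀ m n : ℕ, m < n → f^[m] x ≠ f^[n] x := by
        intro m n hmn heq
        obtain ⟨k, rfl⟩ := Nat.exists_eq_add_of_lt hmn
        have h1 : R (f^[m] x) (f^[m + 1] x) := hmono m 1
        have h2 : R (f^[m + 1] x) (f^[m] x) := by
          rw [heq, show m + k + 1 = (m + 1) + k by omega]
          exact hmono _ _
        have h3 := hcyc _ _ (hs m) h1 h2
        rw [Function.iterate_succ_apply'] at h3
        exact hf' _ (hs m) h3
      have hinj : ∀ m n : ℕ, f^[m] x = f^[n] x → m = n := by
        intro m n h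
        rcases lt_trichotomy m n with h' | h' | h'
        · exact absurd h (hlt _ _ h')
        · exact h'
        · exact absurd h.symm (hlt _ _ h')
      have h := ext {p | ∃ n : ℕ, p = (f^[n] x, n.bodd)} ?_ ?_
      · have : (x, false) ∈ (∅ : Set (U × Bool)) := h ▸ ⟨0, rfl⟩
        exact this
      · rintro w b ⟨n, hn⟩
        cases hn
        refine ⟨?_, f^[n + 1] x, hmono n 1, n + 1, by simp⟩
        rintro ⟨m, hm⟩
        rw [Prod.mk.injEq] at hm
        have := hinj _ _ hm.1
        subst this
        simp at hm
      · rintro w b ⟨n, hn⟩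
        cases hn
        exact hs n
  refine ⟨{y | (y, true) ∈ T}, ?_⟩
  intro x hx
  obtain ⟨y, b, hxy, hy⟩ := key x hx
  obtain ⟨z, hyz, hz⟩ := (hQ y b hy).2
  have hxz : R x z := IsTrans.trans _ _ _ hxy hyz
  cases b with
  | true => exact ⟨⟨y, hxy, hy⟩, ⟨z, hxz, (hQ z _ hz).1⟩⟩
  | false => exact ⟨⟨z, hxz, hz⟩, ⟨y, hxy, (hQ y _ hy).1⟩⟩

/-- Description of the pairs that belong to `IRS R`. -/
theorem mem_IRS_iff (R : U → U → Prop) [IsPreorder U R] (A B : Set U) :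
    (∃ X : Set U, (A, B) = (lowerApprox R X, upperApprox R X)) ↔
      (∀ x y, R x y → x ∈ A → y ∈ A) ∧ (∀ x y, R x y → y ∈ B → x ∈ B) ∧ A ⊆ B ∧
        ∀ x, (∀ y, R x y → y = x) → x ∈ B → x ∈ A := by
  constructor
  · rintro ⟨X, hX⟩
    cases hX
    refine ⟨fun x y hxy hx z hyz => hx z (IsTrans.trans _ _ _ hxy hyz), ?_, ?_, ?_⟩
    · rintro x y hxy ⟨z, hyz, hz⟩
      exact ⟨z, IsTrans.trans _ _ _ hxy hyz, hz⟩
    · exact fun x hx => ⟨x, Std.Refl.refl x, hx x (Std.Refl.refl x)⟩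
    · rintro x hx ⟨y, hxy, hy⟩ z hxz
      rw [hx z hxz, ← hx y hxy]
      exact hy
  · rintro ⟨hA, hB, hAB, hS⟩
    obtain ⟨Y, hY⟩ := exists_splitting_set R
    refine ⟨A ∪ {x | x ∈ B ∧ ∃ y, R x y ∧ y ∉ B} ∪
      {x | x ∈ B ∧ (∀ y, R x y → y ∉ A) ∧ x ∈ Y}, ?_⟩
    have hfree : ∀ x, (∀ y, R x y → y ∈ B) → (∀ y, R x y → y ∉ A) →
        ∀ y, R x y → ∃ z, R y z ∧ z ≠ y := by
      intro x h1 h2 y hxy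
      by_contra! h
      exact h2 y hxy (hS y h (h1 y hxy))
    ext x
    · simp only [lowerApprox]
      constructor
      · intro hx y hxy
        exact Or.inl (Or.inl (hA x y hxy hx))
      · intro hx
        by_contra hxA
        have hxB : x ∈ B := by
          rcases hx x (Std.Refl.refl x) with (h | h) | h
          · exact absurd h hxA
          · exact h.1
          · exact h.1
        by_cases h1 : ∀ y, R x y → y ∈ B
        · by_cases h2 : ∀ y, R x y → y ∉ A
          · obtain ⟨y, hxy, hy⟩ := (hY x (hfree x h1 h2)).2
            rcases hx y hxy with (h | ⟨_, z, hyz, hz⟩) | h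
            · exact h2 y hxy h
            · exact hz (h1 z (IsTrans.trans _ _ _ hxy hyz))
            · exact hy h.2.2
          · rcases hx x (Std.Refl.refl x) with (h | ⟨_, z, hyz, hz⟩) | h
            · exact hxA h
            · exact hz (h1 z hyz)
            · exact h2 h.2.1
        · push Not at h1
          obtain ⟨y, hxy, hy⟩ := h1
          rcases hx y hxy with (h | h) | h
          · exact hy (hAB h)
          · exact hy h.1
          · exact hy h.1
    · simp only [upperApprox]
      constructor
      · intro hx
        by_cases h1 : ∀ y, R x y → y ∈ B
        · by_cases h2 : ∀ y, R x y → y ∉ A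
          · obtain ⟨y, hxy, hy⟩ := (hY x (hfree x h1 h2)).1
            exact ⟨y, hxy, Or.inr ⟨h1 y hxy,
              fun z hyz => h2 z (IsTrans.trans _ _ _ hxy hyz), hy⟩⟩
          · push Not at h2
            obtain ⟨y, hxy, hy⟩ := h2
            exact ⟨y, hxy, Or.inl (Or.inl hy)⟩
        · push Not at h1
          exact ⟨x, Std.Refl.refl x, Or.inl (Or.inr ⟨hx, h1⟩)⟩
      · rintro ⟨y, hxy, hy⟩
        refine hB x y hxy ?_
        rcases hy with (h | h) | h
        · exact hAB h
        · exact h.1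
        · exact h.1

namespace IRS

variable {R : U → U → Prop}

theorem props [IsPreorder U R] (p : IRS R) :
    (∀ x y, R x y → x ∈ p.1.1 → y ∈ p.1.1) ∧ (∀ x y, R x y → y ∈ p.1.2 → x ∈ p.1.2) ∧
      p.1.1 ⊆ p.1.2 ∧ ∀ x, (∀ y, R x y → y = x) → x ∈ p.1.2 → x ∈ p.1.1 :=
  (mem_IRS_iff R p.1.1 p.1.2).1 p.2

/-- The join `(A, B) ∨ (C, D) = (A ∪ C, B ∪ D)`. -/
def join [IsPreorder U R] (p q : IRS R) : IRS R :=
  ⟨(p.1.1 ∪ q.1.1, p.1.2 ∪ q.1.2), by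
    obtain ⟨h1, h2, h3, h4⟩ := p.props
    obtain ⟨k1, k2, k3, k4⟩ := q.props
    rw [mem_IRS_iff]
    refine ⟨fun x y h => Or.imp (h1 x y h) (k1 x y h), fun x y h => Or.imp (h2 x y h) (k2 x y h),
      Set.union_subset_union h3 k3, fun x h => Or.imp (h4 x h) (k4 x h)⟩⟩

/-- The meet `(A, B) ∧ (C, D) = (A ∩ C, B ∩ D)`. -/
def meet [IsPreorder U R] (p q : IRS R) : IRS R :=
  ⟨(p.1.1 ∩ q.1.1, p.1.2 ∩ q.1.2), by
    obtain ⟨h1, h2, h3, h4⟩ := p.props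
    obtain ⟨k1, k2, k3, k4⟩ := q.props
    rw [mem_IRS_iff]
    refine ⟨fun x y h => And.imp (h1 x y h) (k1 x y h),
      fun x y h => And.imp (h2 x y h) (k2 x y h),
      Set.inter_subset_inter h3 k3, fun x h => And.imp (h4 x h) (k4 x h)⟩⟩

/-- Strong negation `∼(A, B) = (-B, -A)`. -/
def compl [IsPreorder U R] (p : IRS R) : IRS R :=
  ⟨(p.1.2ᶜ, p.1.1ᶜ), by
    obtain ⟨h1, h2, h3, h4⟩ := p.props
    rw [mem_IRS_iff]
    exact ⟨fun x y h hx hy => hx (h2 x y h hy), fun x y h hy hx => hy (h1 x y h hx),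
      Set.compl_subset_compl.2 h3, fun x h hx hx' => hx (h4 x h hx')⟩⟩

/-- The operation `(A, B) → (C, D) = ((-A ∪ C)_R, -A ∪ D)`. -/
def arrow [IsPreorder U R] (p q : IRS R) : IRS R :=
  ⟨(lowerApprox R (p.1.1ᶜ ∪ q.1.1), p.1.1ᶜ ∪ q.1.2), by
    obtain ⟨h1, h2, h3, h4⟩ := p.props
    obtain ⟨k1, k2, k3, k4⟩ := q.props
    rw [mem_IRS_iff]
    refine ⟨fun x y h hx z hz => hx z (IsTrans.trans _ _ _ h hz),
      fun x y h => Or.imp (fun hy hx => hy (h1 x y h hx)) (k2 x y h), ?_, ?_⟩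
    · exact fun x hx => Or.imp id (fun h => k3 h) (hx x (Std.Refl.refl x))
    · intro x h hx y hy
      rw [h y hy]
      exact Or.imp id (k4 x h) hx⟩

/-- The greatest element `(U, U)`. -/
def one [IsPreorder U R] : IRS R :=
  ⟨(Set.univ, Set.univ), by rw [mem_IRS_iff]; simp⟩

/-- The least element `(∅, ∅)`. -/
def zero [IsPreorder U R] : IRS R :=
  ⟨(∅, ∅), by rw [mem_IRS_iff]; simp⟩

/-- For a quasiorder `R`, the rough sets form a Nelson algebra, with the order given by
componentwise inclusion. -/
instance [IsPreorder U R] : NelsonAlgebra (IRS R) where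
  le p q := p.1.1 ⊆ q.1.1 ∧ p.1.2 ⊆ q.1.2
  le_refl p := ⟨subset_rfl, subset_rfl⟩
  le_trans p q r h k := ⟨h.1.trans k.1, h.2.trans k.2⟩
  le_antisymm p q h k :=
    Subtype.ext (Prod.ext (h.1.antisymm k.1) (h.2.antisymm k.2))
  sup := join
  le_sup_left p q := ⟨Set.subset_union_left, Set.subset_union_left⟩
  le_sup_right p q := ⟨Set.subset_union_right, Set.subset_union_right⟩
  sup_le p q r h k := ⟨Set.union_subset h.1 k.1, Set.union_subset h.2 k.2⟩
  inf := meet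
  inf_le_left p q := ⟨Set.inter_subset_left, Set.inter_subset_left⟩
  inf_le_right p q := ⟨Set.inter_subset_right, Set.inter_subset_right⟩
  le_inf p q r h k := ⟨Set.subset_inter h.1 k.1, Set.subset_inter h.2 k.2⟩
  le_sup_inf p q r := ⟨(Set.union_inter_distrib_left _ _ _).symm.subset,
    (Set.union_inter_distrib_left _ _ _).symm.subset⟩
  top := one
  le_top p := ⟨Set.subset_univ _, Set.subset_univ _⟩
  bot := zero
  bot_le p := ⟨Set.empty_subset _, Set.empty_subset _⟩
  snot := compl
  wimp := arrow
  snot_snot p := Subtype.ext (Prod.ext (compl_compl _) (compl_compl _))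
  le_iff_snot_le_snot p q :=
    ⟨fun h => ⟨Set.compl_subset_compl.2 h.2, Set.compl_subset_compl.2 h.1⟩,
      fun h => ⟨Set.compl_subset_compl.1 h.2, Set.compl_subset_compl.1 h.1⟩⟩
  inf_snot_le_sup_snot p q := by
    refine ⟨fun x hx => absurd (p.props.2.2.1 hx.1) hx.2, fun x _ => ?_⟩
    by_cases h : x ∈ q.1.1
    · exact Or.inl (q.props.2.2.1 h)
    · exact Or.inr h
  le_wimp_iff p q r := by
    constructor
    · rintro ⟨h1, h2⟩
      refine ⟨fun x hx y hxy => ?_, fun x hx => ?_⟩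
      · by_cases hy : y ∈ p.1.1
        · rcases h1 ⟨hy, r.props.1 x y hxy hx⟩ with h | h
          · exact absurd (p.props.2.2.1 hy) h
          · exact Or.inr h
        · exact Or.inl hy
      · by_cases hy : x ∈ p.1.1
        · exact h2 ⟨p.props.2.2.1 hy, hx⟩
        · exact Or.inl hy
    · rintro ⟨h1, h2⟩
      refine ⟨fun x hx => ?_, fun x hx => h2 hx.2⟩
      rcases h1 hx.2 x (Std.Refl.refl x) with h | h
      · exact absurd hx.1 h
      · exact Or.inr h
  wimp_wimp p q r := by
    refine Subtype.ext (Prod.ext ?_ ?_)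
    · ext x
      constructor
      · intro h y hxy
        by_cases hy : y ∈ p.1.1
        · refine Or.inr fun z hyz => ?_
          rcases h z (IsTrans.trans _ _ _ hxy hyz) with h' | h'
          · exact Or.inl fun hz => h' ⟨p.props.1 y z hyz hy, hz⟩
          · exact Or.inr h'
        · exact Or.inl hy
      · intro h y hxy
        rcases h y hxy with h' | h'
        · exact Or.inl fun hy => h' hy.1
        · rcases h' y (Std.Refl.refl y) with h'' | h''
          · exact Or.inl fun hy => h'' hy.2
          · exact Or.inr h''
    · change (p.1.1 ∩ q.1.1)ᶜ ∪ r.1.2 = p.1.1ᶜ ∪ (q.1.1ᶜ ∪ r.1.2)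
      rw [Set.compl_inter, Set.union_assoc]

end IRS

end RoughSets

/-! A rough set `(A, B)` over a quasiorder is a Kripke truth value for Nelson logic: `A` is the
up-closed set of points that verify a formula, and the complement of `B` the up-closed set of points
that verify its strong negation. Soundness is then a pointwise check of the axioms.

Completeness comes from a filtered canonical model. A non-theorem is omitted by some prime theory.
Only finitely many traces of prime theories on the subformulas and their strong negations exist;
ordered by inclusion, they form a finite Kripke model, and the truth lemma `eval_traceVal`
identifies the two components of a value with membership of `φ` and non-membership of `∼φ`.

One obstacle is special to rough sets: by `mem_IRS_iff`, at a point `x` with `R(x) = {x}` every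
formula must be verified or refuted, which a prime theory need not do. Taking two copies of every
trace removes such points without changing truth. -/

namespace IRS

/-! ### Verification and refutation clauses -/

variable {U : Type u} {R : U → U → Prop} [IsPreorder U R]

theorem mem_inf_fst {p q : IRS R} {x : U} : x ∈ (p ⊓ q).1.1 ↔ x ∈ p.1.1 ∧ x ∈ q.1.1 := Iff.rfl

theorem mem_sup_fst {p q : IRS R} {x : U} : x ∈ (p ⊔ q).1.1 ↔ x ∈ p.1.1 ∨ x ∈ q.1.1 := Iff.rfl

theorem mem_inf_snd {p q : IRS R} {x : U} : x ∈ (p ⊓ q).1.2 ↔ x ∈ p.1.2 ∧ x ∈ q.1.2 := Iff.rfl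

theorem mem_sup_snd {p q : IRS R} {x : U} : x ∈ (p ⊔ q).1.2 ↔ x ∈ p.1.2 ∨ x ∈ q.1.2 := Iff.rfl

theorem mem_snot_fst {p : IRS R} {x : U} : x ∈ (NelsonAlgebra.snot p).1.1 ↔ x ∉ p.1.2 := Iff.rfl

theorem mem_snot_snd {p : IRS R} {x : U} : x ∈ (NelsonAlgebra.snot p).1.2 ↔ x ∉ p.1.1 := Iff.rfl

theorem mem_wimp_fst {p q : IRS R} {x : U} :
    x ∈ (NelsonAlgebra.wimp p q).1.1 ↔ ∀ y, R x y → y ∈ p.1.1 → y ∈ q.1.1 :=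
  forall₂_congr fun _ _ => imp_iff_not_or.symm

/-- No successors are quantified over: an implication is refuted at `x` exactly when `x` itself
verifies `p` and refutes `q`. -/
theorem mem_wimp_snd {p q : IRS R} {x : U} :
    x ∈ (NelsonAlgebra.wimp p q).1.2 ↔ (x ∈ p.1.1 → x ∈ q.1.2) :=
  imp_iff_not_or.symm

theorem mem_wnot_fst {p : IRS R} {x : U} :
    x ∈ (NelsonAlgebra.wnot p).1.1 ↔ ∀ y, R x y → y ∉ p.1.1 :=
  mem_wimp_fst

theorem mem_wnot_snd {p : IRS R} {x : U} : x ∈ (NelsonAlgebra.wnot p).1.2 ↔ x ∉ p.1.1 :=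
  mem_wimp_snd

/-- The first component is contained in the second, so validity only concerns verification. -/
theorem eq_top_iff_fst {p : IRS R} : p = ⊤ ↔ ∀ x, x ∈ p.1.1 := by
  constructor
  · rintro rfl x
    exact Set.mem_univ x
  · intro h
    exact top_le_iff.1 ⟨fun x _ => h x, fun x _ => p.props.2.2.1 (h x)⟩

end IRS

namespace NelsonFormula

/-! ### Soundness -/

section Soundness

variable {V : Type v} {U : Type u} {R : U → U → Prop} [IsPreorder U R]

theorem IsTheorem.validIn_IRS {α : NelsonFormula V} (h : IsTheorem α) : ValidIn (IRS R) α := by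
  intro val
  rw [IRS.eq_top_iff_fst]
  have refl : ∀ x, R x x := fun x => Std.Refl.refl x
  have trans : ∀ x y z, R x y → R y z → R x z := fun x y z => IsTrans.trans x y z
  have up : ∀ (β : NelsonFormula V) x y, R x y → x ∈ (eval val β).1.1 → y ∈ (eval val β).1.1 :=
    fun β => (eval val β).props.1
  have down : ∀ (β : NelsonFormula V) x y, R x y → y ∈ (eval val β).1.2 → x ∈ (eval val β).1.2 :=
    fun β => (eval val β).props.2.1
  have sub : ∀ (β : NelsonFormula V) x, x ∈ (eval val β).1.1 → x ∈ (eval val β).1.2 :=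
    fun β => (eval val β).props.2.2.1
  induction h with
  | modus_ponens _ _ ih₁ ih₂ =>
    exact fun x => IRS.mem_wimp_fst.1 (ih₁ x) x (refl x) (ih₂ x)
  -- Each axiom unfolds to a first-order statement about points, to be derived from the preorder
  -- laws, persistence and `A ⊆ B`.
  | _ =>
    intro x
    simp only [equ, eval, IRS.mem_wimp_fst, IRS.mem_wimp_snd, IRS.mem_inf_fst, IRS.mem_sup_fst,
      IRS.mem_inf_snd, IRS.mem_sup_snd, IRS.mem_snot_fst, IRS.mem_snot_snd, IRS.mem_wnot_fst,
      IRS.mem_wnot_snd]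
    grind

end Soundness

/-! ### Prime theories and their extensions -/

section Theories

variable {V : Type v}

/-- A set of formulas that contains all theorems and is closed under modus ponens. -/
structure IsTheory (T : Set (NelsonFormula V)) : Prop where
  of_isTheorem : ∀ {φ}, IsTheorem φ → φ ∈ T
  mp : ∀ {φ ψ}, (φ ⇀ ψ) ∈ T → φ ∈ T → ψ ∈ T

theorem isTheory_setOf_isTheorem : IsTheory {φ : NelsonFormula V | IsTheorem φ} :=
  ⟨id, IsTheorem.modus_ponens⟩

namespace IsTheory

variable {T : Set (NelsonFormula V)} {φ ψ χ : NelsonFormula V}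

theorem mp_of_isTheorem (hT : IsTheory T) (h : IsTheorem (φ ⇀ ψ)) (hφ : φ ∈ T) : ψ ∈ T :=
  hT.mp (hT.of_isTheorem h) hφ

theorem imp_self_mem (hT : IsTheory T) (φ : NelsonFormula V) : (φ ⇀ φ) ∈ T :=
  hT.mp (hT.mp_of_isTheorem (.imp_distrib φ (φ ⇀ φ) φ) (hT.of_isTheorem (.imp_const _ _)))
    (hT.of_isTheorem (.imp_const _ _))

theorem imp_mem_of_mem (hT : IsTheory T) (hψ : ψ ∈ T) : (φ ⇀ ψ) ∈ T :=
  hT.mp_of_isTheorem (.imp_const _ _) hψ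

theorem conj_mem_iff (hT : IsTheory T) : (φ ⩓ ψ) ∈ T ↔ φ ∈ T ∧ ψ ∈ T := by
  refine ⟨fun h => ⟨hT.mp_of_isTheorem (.conj_left _ _) h, hT.mp_of_isTheorem (.conj_right _ _) h⟩,
    fun ⟨h₁, h₂⟩ => ?_⟩
  exact hT.mp (hT.mp (hT.mp_of_isTheorem (.conj_intro φ φ ψ) (hT.imp_self_mem φ))
    (hT.imp_mem_of_mem h₂)) h₁

theorem mem_iff_of_equ (hT : IsTheory T) (h : IsTheorem (φ ⇌ₙ ψ)) : φ ∈ T ↔ ψ ∈ T :=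
  ⟨hT.mp_of_isTheorem (.modus_ponens (.conj_left _ _) h),
    hT.mp_of_isTheorem (.modus_ponens (.conj_right _ _) h)⟩

/-- With no constant for falsity in the language, this reduces a missing `¬φ` to a missing
implication `φ → ψ`. -/
theorem neg_mem_of_imp (hT : IsTheory T) (h : ∀ ψ, (φ ⇀ ψ) ∈ T) : (¬ₙφ) ∈ T :=
  hT.mp (hT.mp_of_isTheorem (.neg_intro φ φ) (h φ)) (h (¬ₙφ))

/-- By the deduction theorem, the theory generated by `T` and `φ`. -/
theorem setOf_imp_mem (hT : IsTheory T) (φ : NelsonFormula V) : IsTheory {ψ | (φ ⇀ ψ) ∈ T} :=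
  ⟨fun h => hT.imp_mem_of_mem (hT.of_isTheorem h),
    fun h₁ h₂ => hT.mp (hT.mp_of_isTheorem (.imp_distrib _ _ _) h₁) h₂⟩

end IsTheory

/-- Consistent theories with the disjunction property. -/
structure IsPrimeTheory (T : Set (NelsonFormula V)) : Prop extends IsTheory T where
  exists_notMem : ∃ φ, φ ∉ T
  mem_or_mem : ∀ {φ ψ}, (φ ⩔ ψ) ∈ T → φ ∈ T ∨ ψ ∈ T

/-- A theory maximal among those omitting `χ` is prime: it contains `φ → χ` for every `φ` outside
it, so omitting both disjuncts while containing the disjunction would yield `χ`. -/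
theorem IsTheory.exists_isPrimeTheory {T : Set (NelsonFormula V)} (hT : IsTheory T)
    {χ : NelsonFormula V} (hχ : χ ∉ T) : ∃ T', IsPrimeTheory T' ∧ T ⊆ T' ∧ χ ∉ T' := by
  obtain ⟨M, hTM, hM⟩ := zorn_subset_nonempty {S | IsTheory S ∧ χ ∉ S} (by
    rintro c hc hch ⟨S₀, hS₀⟩
    refine ⟨⋃₀ c, ⟨⟨fun h => ⟨S₀, hS₀, (hc hS₀).1.of_isTheorem h⟩, ?_⟩, ?_⟩,
      fun s hs => Set.subset_sUnion_of_mem hs⟩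
    · rintro φ ψ ⟨S₁, h₁, hφψ⟩ ⟨S₂, h₂, hφ⟩
      rcases hch.total h₁ h₂ with h | h
      · exact ⟨S₂, h₂, (hc h₂).1.mp (h hφψ) hφ⟩
      · exact ⟨S₁, h₁, (hc h₁).1.mp hφψ (h hφ)⟩
    · rintro ⟨S, hS, h⟩
      exact (hc hS).2 h) T ⟨hT, hχ⟩
  obtain ⟨hMT, hMχ⟩ := hM.prop
  have key : ∀ φ, φ ∉ M → (φ ⇀ χ) ∈ M := by
    intro φ hφ
    by_contra h
    -- If `φ → χ` were missing, the theory generated by `M` and `φ` would still omit `χ`, so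
    -- maximality would put `φ` in `M`.
    exact hφ (hM.le_of_ge (y := {ψ | (φ ⇀ ψ) ∈ M}) ⟨hMT.setOf_imp_mem φ, h⟩
      (fun ψ hψ => hMT.imp_mem_of_mem hψ) (hMT.imp_self_mem φ))
  refine ⟨M, ⟨hMT, ⟨χ, hMχ⟩, fun {φ ψ} h => ?_⟩, hTM, hMχ⟩
  by_contra! hn
  exact hMχ (hMT.mp (hMT.mp (hMT.mp_of_isTheorem (.disj_elim φ ψ χ) (key φ hn.1))
    (key ψ hn.2)) h)

namespace IsPrimeTheory

variable {T : Set (NelsonFormula V)} {φ ψ : NelsonFormula V}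

theorem disj_mem_iff (hT : IsPrimeTheory T) : (φ ⩔ ψ) ∈ T ↔ φ ∈ T ∨ ψ ∈ T :=
  ⟨hT.mem_or_mem, Or.rec (hT.mp_of_isTheorem (.disj_left _ _))
    (hT.mp_of_isTheorem (.disj_right _ _))⟩

theorem notMem_of_sneg_mem (hT : IsPrimeTheory T) (h : (∼ₙφ) ∈ T) : φ ∉ T := by
  obtain ⟨χ, hχ⟩ := hT.exists_notMem
  exact fun hφ => hχ (hT.mp (hT.mp_of_isTheorem (.sneg_elim φ χ) h) hφ)

theorem notMem_of_neg_mem (hT : IsPrimeTheory T) (h : (¬ₙφ) ∈ T) : φ ∉ T := by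
  obtain ⟨χ, hχ⟩ := hT.exists_notMem
  exact fun hφ => hχ (hT.mp (hT.mp_of_isTheorem (.neg_elim φ χ) h) hφ)

theorem exists_of_imp_notMem (hT : IsPrimeTheory T) (h : (φ ⇀ ψ) ∉ T) :
    ∃ T', IsPrimeTheory T' ∧ T ⊆ T' ∧ φ ∈ T' ∧ ψ ∉ T' := by
  obtain ⟨T', hT', hsub, hψ⟩ := (hT.setOf_imp_mem φ).exists_isPrimeTheory h
  exact ⟨T', hT', fun χ hχ => hsub (hT.imp_mem_of_mem hχ), hsub (hT.imp_self_mem φ), hψ⟩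

theorem exists_of_neg_notMem (hT : IsPrimeTheory T) (h : (¬ₙφ) ∉ T) :
    ∃ T', IsPrimeTheory T' ∧ T ⊆ T' ∧ φ ∈ T' := by
  obtain ⟨ψ, hψ⟩ : ∃ ψ, (φ ⇀ ψ) ∉ T := by
    by_contra! hn
    exact h (hT.neg_mem_of_imp hn)
  obtain ⟨T', hT', hsub, hφ, -⟩ := hT.exists_of_imp_notMem hψ
  exact ⟨T', hT', hsub, hφ⟩

end IsPrimeTheory

end Theories

/-! ### The finite model of doubled traces -/

section FiniteModel

variable {V : Type v}

/-- The set of subformulas of a formula. -/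
def subformulas : NelsonFormula V → Set (NelsonFormula V)
  | .var p => {.var p}
  | .conj φ ψ => insert (φ ⩓ ψ) (subformulas φ ∪ subformulas ψ)
  | .disj φ ψ => insert (φ ⩔ ψ) (subformulas φ ∪ subformulas ψ)
  | .imp φ ψ => insert (φ ⇀ ψ) (subformulas φ ∪ subformulas ψ)
  | .neg φ => insert (¬ₙφ) (subformulas φ)
  | .sneg φ => insert (∼ₙφ) (subformulas φ)

theorem self_mem_subformulas (φ : NelsonFormula V) : φ ∈ subformulas φ := by
  cases φ <;> simp [subformulas]

theorem finite_subformulas (φ : NelsonFormula V) : (subformulas φ).Finite := by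
  induction φ with
  | var p => exact Set.finite_singleton _
  | conj φ ψ ih₁ ih₂ => exact (ih₁.union ih₂).insert _
  | disj φ ψ ih₁ ih₂ => exact (ih₁.union ih₂).insert _
  | imp φ ψ ih₁ ih₂ => exact (ih₁.union ih₂).insert _
  | neg φ ih => exact ih.insert _
  | sneg φ ih => exact ih.insert _

/-- The subformulas of `α` and their strong negations. -/
def signedSubformulas (α : NelsonFormula V) : Set (NelsonFormula V) :=
  subformulas α ∪ NelsonFormula.sneg '' subformulas α

theorem finite_signedSubformulas (α : NelsonFormula V) : (signedSubformulas α).Finite :=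
  (finite_subformulas α).union ((finite_subformulas α).image _)

/-- The traces of prime theories on `signedSubformulas α`. -/
def traces (α : NelsonFormula V) : Set (Set (NelsonFormula V)) :=
  {s | ∃ T, IsPrimeTheory T ∧ s = T ∩ signedSubformulas α}

theorem finite_traces (α : NelsonFormula V) : (traces α).Finite :=
  (finite_signedSubformulas α).finite_subsets.subset (by
    rintro s ⟨T, -, rfl⟩
    exact Set.inter_subset_right)

/-- The quasiorder on `U` that compares the traces assigned to the points. -/
def traceRel {α : NelsonFormula V} {U : Type u} (π : U → traces α) (x y : U) : Prop :=
  (π x).1 ⊆ (π y).1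

instance {α : NelsonFormula V} {U : Type u} (π : U → traces α) :
    IsPreorder U (traceRel π) where
  refl _ := subset_rfl
  trans _ _ _ h₁ h₂ := Set.Subset.trans h₁ h₂

variable {α : NelsonFormula V} {U : Type u} {π : U → traces α}

/-- The valuation read off from the traces. It consists of rough sets because every trace is
attached to at least two points. -/
def traceVal (hπ : ∀ x, ∃ y, y ≠ x ∧ π y = π x) (p : V) : IRS (traceRel π) :=
  ⟨({x | NelsonFormula.var p ∈ (π x).1}, {x | (∼ₙ(.var p)) ∉ (π x).1}), by
    rw [mem_IRS_iff]
    refine ⟨fun x y h hx => h hx, fun x y h hy hx => hy (h hx), fun x hx hx' => ?_,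
      fun x hx _ => ?_⟩
    · obtain ⟨T, hT, h⟩ := (π x).2
      simp only [Set.mem_ofPred_eq, h] at hx hx'
      exact hT.notMem_of_sneg_mem hx'.1 hx.1
    · obtain ⟨y, hne, hy⟩ := hπ x
      -- The twin `y` of `x` lies in `R(x)`, so the condition on points with `R(x) = {x}` is
      -- vacuous.
      exact absurd (hx y (hy ▸ subset_rfl : (π x).1 ⊆ (π y).1)) hne⟩

/-- Truth lemma, stated for every prime theory with the trace of `x`. Strong negations of compound
formulas are decomposed inside the theory, so only those of variables are read off the trace. -/
theorem eval_traceVal (hπ : ∀ x, ∃ y, y ≠ x ∧ π y = π x) (hs : Function.Surjective π)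
    (φ : NelsonFormula V) (hφ : subformulas φ ⊆ subformulas α) (T : Set (NelsonFormula V))
    (hT : IsPrimeTheory T) (x : U) (hx : (π x).1 = T ∩ signedSubformulas α) :
    (x ∈ (eval (traceVal hπ) φ).1.1 ↔ φ ∈ T) ∧
      (x ∈ (eval (traceVal hπ) φ).1.2 ↔ (∼ₙφ) ∉ T) := by
  have lift : ∀ T', IsPrimeTheory T' → ∃ y, (π y).1 = T' ∩ signedSubformulas α := by
    intro T' hT'
    obtain ⟨y, hy⟩ := hs ⟨_, T', hT', rfl⟩
    exact ⟨y, by rw [hy]⟩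
  -- This fact depends on `T` and `x`, so each induction hypothesis asks for its own instance.
  have mem : ∀ {ψ y}, traceRel π x y → ψ ∈ subformulas α → ψ ∈ T → ψ ∈ (π y).1 :=
    fun h hψ hψT => h (hx ▸ ⟨hψT, Or.inl hψ⟩)
  induction φ generalizing T x with
  | var p =>
    have h₁ : NelsonFormula.var p ∈ signedSubformulas α := Or.inl (hφ rfl)
    have h₂ : (∼ₙ(.var p)) ∈ signedSubformulas α := Or.inr ⟨_, hφ rfl, rfl⟩
    simp only [eval, traceVal, Set.mem_ofPred_eq, hx, Set.mem_inter_iff, h₁, h₂, and_true,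
      and_self]
  | conj φ ψ ih₁ ih₂ =>
    simp only [subformulas, Set.insert_subset_iff, Set.union_subset_iff] at hφ
    obtain ⟨h₁, h₁'⟩ := ih₁ hφ.2.1 T hT x hx mem
    obtain ⟨h₂, h₂'⟩ := ih₂ hφ.2.2 T hT x hx mem
    rw [eval, IRS.mem_inf_fst, IRS.mem_inf_snd, h₁, h₂, h₁', h₂', hT.conj_mem_iff,
      hT.mem_iff_of_equ (.sneg_conj φ ψ), hT.disj_mem_iff, not_or]
    exact ⟨Iff.rfl, Iff.rfl⟩
  | disj φ ψ ih₁ ih₂ =>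
    simp only [subformulas, Set.insert_subset_iff, Set.union_subset_iff] at hφ
    obtain ⟨h₁, h₁'⟩ := ih₁ hφ.2.1 T hT x hx mem
    obtain ⟨h₂, h₂'⟩ := ih₂ hφ.2.2 T hT x hx mem
    rw [eval, IRS.mem_sup_fst, IRS.mem_sup_snd, h₁, h₂, h₁', h₂', hT.disj_mem_iff,
      hT.mem_iff_of_equ (.sneg_disj φ ψ), hT.conj_mem_iff, not_and_or]
    exact ⟨Iff.rfl, Iff.rfl⟩
  | imp φ ψ ih₁ ih₂ =>
    simp only [subformulas, Set.insert_subset_iff, Set.union_subset_iff] at hφ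
    obtain ⟨h₁, -⟩ := ih₁ hφ.2.1 T hT x hx mem
    obtain ⟨-, h₂⟩ := ih₂ hφ.2.2 T hT x hx mem
    rw [eval, IRS.mem_wimp_fst, IRS.mem_wimp_snd, h₁, h₂, hT.mem_iff_of_equ (.sneg_imp φ ψ),
      hT.conj_mem_iff, not_and]
    refine ⟨⟨fun h => ?_, fun h y hxy hy => ?_⟩, Iff.rfl⟩
    · by_contra hn
      obtain ⟨T', hT', hTT', hφT', hψT'⟩ := hT.exists_of_imp_notMem hn
      obtain ⟨y, hy⟩ := lift T' hT'
      have hxy : traceRel π x y := by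
        rw [traceRel, hx, hy]
        exact Set.inter_subset_inter_left _ hTT'
      have memy : ∀ {ψ z}, traceRel π y z → ψ ∈ subformulas α → ψ ∈ T' → ψ ∈ (π z).1 :=
        fun h hψ hψT => h (hy ▸ ⟨hψT, Or.inl hψ⟩)
      exact hψT' ((ih₂ hφ.2.2 T' hT' y hy memy).1.1
        (h y hxy ((ih₁ hφ.2.1 T' hT' y hy memy).1.2 hφT')))
    -- A theory `T'` behind `y` need not extend `T`; inclusion of traces suffices because `φ → ψ` is
    -- a subformula of `α`.
    · obtain ⟨T', hT', hyT'⟩ := (π y).2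
      have memy : ∀ {ψ z}, traceRel π y z → ψ ∈ subformulas α → ψ ∈ T' → ψ ∈ (π z).1 :=
        fun h hψ hψT => h (hyT' ▸ ⟨hψT, Or.inl hψ⟩)
      have himp := mem hxy hφ.1 h
      rw [hyT'] at himp
      exact (ih₂ hφ.2.2 T' hT' y hyT' memy).1.2
        (hT'.mp himp.1 ((ih₁ hφ.2.1 T' hT' y hyT' memy).1.1 hy))
  | neg φ ih =>
    simp only [subformulas, Set.insert_subset_iff] at hφ
    obtain ⟨h₁, -⟩ := ih hφ.2 T hT x hx mem
    rw [eval, IRS.mem_wnot_fst, IRS.mem_wnot_snd, h₁, hT.mem_iff_of_equ (.sneg_neg φ)]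
    refine ⟨⟨fun h => ?_, fun h y hxy hy => ?_⟩, Iff.rfl⟩
    · by_contra hn
      obtain ⟨T', hT', hTT', hφT'⟩ := hT.exists_of_neg_notMem hn
      obtain ⟨y, hy⟩ := lift T' hT'
      have hxy : traceRel π x y := by
        rw [traceRel, hx, hy]
        exact Set.inter_subset_inter_left _ hTT'
      exact h y hxy ((ih hφ.2 T' hT' y hy
        (fun h hψ hψT => h (hy ▸ ⟨hψT, Or.inl hψ⟩))).1.2 hφT')
    · obtain ⟨T', hT', hyT'⟩ := (π y).2
      have hneg := mem hxy hφ.1 h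
      rw [hyT'] at hneg
      exact hT'.notMem_of_neg_mem hneg.1 ((ih hφ.2 T' hT' y hyT'
        (fun h hψ hψT => h (hyT' ▸ ⟨hψT, Or.inl hψ⟩))).1.1 hy)
  | sneg φ ih =>
    simp only [subformulas, Set.insert_subset_iff] at hφ
    obtain ⟨h₁, h₂⟩ := ih hφ.2 T hT x hx mem
    rw [eval, IRS.mem_snot_fst, IRS.mem_snot_snd, h₁, h₂, hT.mem_iff_of_equ (.sneg_sneg φ),
      not_not]
    exact ⟨Iff.rfl, Iff.rfl⟩

theorem isTheorem_of_forall_finite {α : NelsonFormula V}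
    (h : ∀ (U : Type u) (R : U → U → Prop) [IsPreorder U R], Finite U → ValidIn (IRS R) α) :
    IsTheorem α := by
  by_contra hα
  obtain ⟨T, hT, -, hαT⟩ := isTheory_setOf_isTheorem.exists_isPrimeTheory hα
  have : Finite (traces α) := (finite_traces α).to_subtype
  obtain ⟨n, ⟨e⟩⟩ := Finite.exists_equiv_fin (traces α)
  -- The Boolean factor supplies the twins, and `ULift` moves the points to the universe `u`,
  -- independent of that of `V`.
  let π : ULift.{u} (Fin n × Bool) → traces α := fun x => e.symm x.down.1
  have hs : Function.Surjective π := fun t => ⟨⟨(e t, true)⟩, e.symm_apply_apply t⟩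
  have hπ : ∀ x, ∃ y, y ≠ x ∧ π y = π x := by
    rintro ⟨i, b⟩
    exact ⟨⟨(i, !b)⟩, by simp, rfl⟩
  obtain ⟨x, hx⟩ := hs ⟨_, T, hT, rfl⟩
  have hval := IRS.eq_top_iff_fst.1 (h _ (traceRel π) inferInstance (traceVal hπ)) x
  exact hαT ((eval_traceVal hπ hs α subset_rfl T hT x (by rw [hx])).1.1 hval)

end FiniteModel

end NelsonFormula

/-- For a formula `α` of constructive logic with strong negation, the following are equivalent:
`α` is a theorem; `α` is valid in every finite Nelson algebra `IRS R` determined by a quasiorder;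
`α` is valid in `IRS R` for every quasiorder `R` on a finite set. -/
theorem mainTheorem2 {V : Type v} (α : NelsonFormula V) :
    List.TFAE [
      NelsonFormula.IsTheorem α,
      ∀ (U : Type u) (R : U → U → Prop) [IsPreorder U R], Finite (IRS R) →
        NelsonFormula.ValidIn (IRS R) α,
      ∀ (U : Type u) (R : U → U → Prop) [IsPreorder U R], Finite U →
        NelsonFormula.ValidIn (IRS R) α] := by
  tfae_have 1 → 2 := fun h U R _ _ => h.validIn_IRS
  tfae_have 2 → 3 := by
    intro h U R _ _
    have : Finite (IRS R) := Subtype.finite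
    exact h U R this
  tfae_have 3 → 1 := NelsonFormula.isTheorem_of_forall_finite
  tfae_finish
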